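/- Let $\alpha,\beta\in[0,1]$ with $\alpha>0$. Consider the probabilistic cellular automaton $F$ on $\{\ominus,\oplus\}^{\mathbb Z}$: given the configuration $x^t$ at time $t$, the components $x^{t+1}_k$, $k\in\mathbb Z$, are independent, and $x^{t+1}_k=\oplus$ with probability $\theta(\oplus\,|\,x^t_kx^t_{k+1})$, where $$\theta(\oplus|\ominus\ominus)=0,\quad \theta(\oplus|\oplus\ominus)=\beta,\quad \theta(\oplus|\ominus\oplus)=\alpha,\quad \theta(\oplus|\oplus\oplus)=1 .$$ An island of minuses is a configuration that differs from "all pluses" at only finitely many sites; if it has at least one minus, its length is $b-a+1$, where $a$ and $b$ are the leftmost and the rightmost site in state $\ominus$. Let $\mu$ be an archipelago of minuses, i.e. a probability measure on $\{\ominus,\oplus\}^{\mathbb Z}$ concentrated on the (countable) set of islands of minuses, and suppose that its giant, i.e. the supremum of the lengths of the islands that have positive $\mu$-mass, is finite. Let $(x^t)_{t\ge 0}$ be the Markov chain with initial distribution $\mu$ and the above transitions, and let $$\tau_\mu=\inf\{t\ge 0:\ x^t\text{ is "all minuses" or "all pluses"}\}\in[0,\infty],\qquad \inf\emptyset=\infty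 .$$ Then almost surely $\tau_\mu=\inf\{t\ge0: x^t\text{ is "all pluses"}\}$, and (A) if $\alpha>1-\beta$, then $\mathbb E(\tau_\mu)<\infty$; (B) if $\alpha\le 1-\beta$ and $\mu\neq\delta_\oplus$ (the point mass at "all pluses"), then $\mathbb E(\tau_\mu)=\infty$. -/

import Mathlib

open MeasureTheory ProbabilityTheory
open scoped ENNReal unitInterval

/-- The two states of a component: `true` is plus, `false` is minus. -/
abbrev Spin : Type := Bool

/-- Plus. -/
abbrev Spin.plus : Spin := true

/-- Minus. -/
abbrev Spin.minus : Spin := false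

/-- Configurations on `ℤ`, with the product (cylinder) sigma-algebra. -/
abbrev Config : Type := ℤ → Spin

/-- The configuration all of whose components are pluses. -/
def allPlus : Config := fun _ => Spin.plus

/-- The configuration all of whose components are minuses. -/
def allMinus : Config := fun _ => Spin.minus

/-- Two configurations are close if they differ at finitely many sites only. -/
def Close (x y : Config) : Prop := {i : ℤ | x i ≠ y i}.Finite

/-- The configurations close to "all pluses". -/
def islandsOfMinuses : Set Config := {x | Close x allPlus}

/-- `x` is, up to the sites strictly between `i` and `j`, constantly equal to the spin opposite
to `s`; the two extreme sites strictly between `i` and `j` carry `s`; and `n = j - i - 1`. -/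
def HasLength (s : Spin) (x : Config) (n : ℕ) : Prop :=
  ∃ i j : ℤ, i < j ∧ x (i + 1) = s ∧ x (j - 1) = s ∧
    (∀ k : ℤ, k ≤ i ∨ j ≤ k → x k = !s) ∧ (n : ℤ) = j - i - 1

/-- Archipelagos of minuses: normalized measures concentrated on the islands of minuses. -/
def IsArchipelagoOfMinuses (μ : Measure Config) [IsProbabilityMeasure μ] : Prop :=
  ∀ᵐ x ∂μ, x ∈ islandsOfMinuses

/-- The greatest length of the islands (of either sign) charged by `μ`, and `⊤` if there is no
greatest length. -/
noncomputable def giant (μ : Measure Config) : ℕ∞ :=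
  sSup {m : ℕ∞ | ∃ (s : Spin) (x : Config) (n : ℕ), μ {x} ≠ 0 ∧ HasLength s x n ∧ m = n}

/-- The probability `θ(+ | a₀ a₁)` that a component is plus at the next time step, when it is now
in state `a₀` and its right neighbour is in state `a₁`. -/
def thetaPlus (α β : I) : Spin → Spin → I
  | false, false => 0
  | true, false => β
  | false, true => α
  | true, true => 1

/-- The law on `Spin` that gives mass `p` to plus and mass `1 - p` to minus. -/
noncomputable def spinLaw (p : I) : Measure Spin :=
  ENNReal.ofReal (p : ℝ) • Measure.dirac Spin.plus +
    ENNReal.ofReal (1 - (p : ℝ)) • Measure.dirac Spin.minus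

instance spinLaw.instIsProbabilityMeasure (p : I) : IsProbabilityMeasure (spinLaw p) := by
  constructor
  have h : ENNReal.ofReal (p : ℝ) + ENNReal.ofReal (1 - (p : ℝ)) = 1 := by
    rw [← ENNReal.ofReal_add p.2.1 (by linarith [p.2.2])]
    simp
  simpa [spinLaw] using h

/-- The law of the next configuration, given that the present one is `x`: the components are
updated independently, the `k`-th one according to `θ(· | x_k x_{k+1})`. -/
noncomputable def stepLaw (α β : I) (x : Config) : Measure Config :=
  Measure.infinitePi fun k : ℤ => spinLaw (thetaPlus α β (x k) (x (k + 1)))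

instance stepLaw.instIsProbabilityMeasure (α β : I) (x : Config) :
    IsProbabilityMeasure (stepLaw α β x) := by
  unfold stepLaw
  infer_instance

theorem stepLaw_pi (α β : I) (x : Config) (s : Finset ℤ) (t : ℤ → Set Spin) :
    stepLaw α β x ((s : Set ℤ).pi t)
      = ∏ k ∈ s, spinLaw (thetaPlus α β (x k) (x (k + 1))) (t k) :=
  Measure.infinitePi_pi (X := fun _ : ℤ => Spin)
    (μ := fun k : ℤ => spinLaw (thetaPlus α β (x k) (x (k + 1))))
    (fun _ _ => MeasurableSet.of_discrete)

theorem measurable_pair_apply (g : Spin → Spin → ℝ≥0∞) (k l : ℤ) :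
    Measurable fun x : Config => g (x k) (x l) := by
  have hg : Measurable fun p : Spin × Spin => g p.1 p.2 := measurable_of_countable _
  have hx : Measurable fun x : Config => (x k, x l) :=
    (measurable_pi_apply k).prodMk (measurable_pi_apply l)
  exact hg.comp hx

theorem measurable_stepLaw_pi (α β : I) (s : Finset ℤ) (t : ℤ → Set Spin) :
    Measurable fun x : Config => stepLaw α β x ((s : Set ℤ).pi t) := by
  simp_rw [stepLaw_pi]
  refine Finset.measurable_fun_prod s fun k _ => ?_
  exact measurable_pair_apply (fun a b => spinLaw (thetaPlus α β a b) (t k)) k (k + 1)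

theorem measurable_stepLaw (α β : I) : Measurable (stepLaw α β) := by
  have hpi : IsPiSystem (squareCylinders fun _ : ℤ => {s : Set Spin | MeasurableSet s}) :=
    isPiSystem_squareCylinders (fun _ => MeasurableSpace.isPiSystem_measurableSet)
      (fun _ => (MeasurableSet.univ : MeasurableSet (Set.univ : Set Spin)))
  refine Measurable.measure_of_isPiSystem_of_isProbabilityMeasure
    (generateFrom_squareCylinders (α := fun _ : ℤ => Spin)).symm hpi ?_
  rintro A ⟨s, t, -, rfl⟩
  exact measurable_stepLaw_pi α β s t

/-- The transition kernel of the cellular automaton `F`; the operator is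
`μ F = μ.bind (kernelF α β)`. -/
noncomputable def kernelF (α β : I) : Kernel Config Config where
  toFun := stepLaw α β
  measurable' := measurable_stepLaw α β

instance kernelF.instIsMarkovKernel (α β : I) : IsMarkovKernel (kernelF α β) :=
  ⟨fun x => stepLaw.instIsProbabilityMeasure α β x⟩

/-- The law of the trajectory `(x⁰, x¹, x², …)` of the process: the Markov chain on
configurations with initial distribution `μ` and transition kernel `kernelF α β`. -/
noncomputable def processLaw (α β : I) (μ : Measure Config) [IsProbabilityMeasure μ] :
    Measure (ℕ → Config) :=
  Kernel.trajMeasure (X := fun _ : ℕ => Config) μ fun n =>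
    (kernelF α β).comap (fun h : (i : Finset.Iic n) → Config => h ⟨n, Finset.mem_Iic.2 le_rfl⟩)
      (measurable_pi_apply _)

/-- The first time `t ≥ 0` at which the trajectory `ω` is in `S`; `∞` if there is none. -/
noncomputable def hitTime (S : Set Config) (ω : ℕ → Config) : ℝ≥0∞ :=
  ⨅ (t : ℕ) (_ : ω t ∈ S), (t : ℝ≥0∞)

/-- The random time `τ`: the first time at which the trajectory is in one of the two
configurations "all minuses", "all pluses". -/
noncomputable def tau (ω : ℕ → Config) : ℝ≥0∞ := hitTime {allMinus, allPlus} ω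

/-! Let N be the number of minuses. The sum over k of (1 - α)[x_k = ⊖] + α[x_{k+1} = ⊖] is N(x), and
its summand equals the probability of a minus at k after one step, except at pairs ⊕⊖, where it is α
instead of 1 - β. So one step changes the mean of N by (1 - α - β) times the number of pairs ⊕⊖, and
a bounded island with a minus has at least one such pair (`tsum_minus_average`,
`lintegral_stepLaw_add_le`). "All pluses" is absorbing, so its mean hitting time is the sum over n
of P(xⁿ ≠ "all pluses"). If α > 1 - β, each such n costs N at least α + β - 1 on average, which
bounds the sum. If α ≤ 1 - β, the mean of N never decreases, while N ≤ M + n at time n because a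
window grows by at most one site per step; the probabilities then dominate a harmonic series. -/

/-! ### Counting and confining the minuses. -/

/-- The number of minuses of a configuration. -/
noncomputable def minusCount (x : Config) : ℝ≥0∞ := ∑' k : ℤ, if x k = Spin.minus then 1 else 0

/-- All minuses of `x` lie in some window of `n` consecutive sites. -/
def InWindow (n : ℕ) (x : Config) : Prop :=
  ∃ a : ℤ, ∀ k : ℤ, x k = Spin.minus → a ≤ k ∧ k < a + n

theorem measurable_minusCount : Measurable minusCount := by
  unfold minusCount
  refine Measurable.tsum fun k => ?_
  exact (measurable_of_countable fun s : Spin => if s = Spin.minus then (1 : ℝ≥0∞) else 0).comp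
    (measurable_pi_apply k)

theorem exists_minus_of_ne_allPlus {x : Config} (hx : x ≠ allPlus) :
    ∃ k, x k = Spin.minus := by
  by_contra! h
  exact hx (funext fun k => (Bool.eq_true_of_not_eq_false (h k) : x k = true))

theorem InWindow.ne_allMinus {n : ℕ} {x : Config} (hx : InWindow n x) : x ≠ allMinus := by
  rintro rfl
  obtain ⟨a, ha⟩ := hx
  have := (ha (a - 1) rfl).1
  omega

theorem minusCount_allPlus : minusCount allPlus = 0 := by
  simp [minusCount, allPlus]

theorem one_le_minusCount {x : Config} (hx : x ≠ allPlus) : 1 ≤ minusCount x := by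
  obtain ⟨k, hk⟩ := exists_minus_of_ne_allPlus hx
  have := ENNReal.le_tsum (f := fun k : ℤ => if x k = Spin.minus then (1 : ℝ≥0∞) else 0) k
  rw [if_pos hk] at this
  exact this

theorem InWindow.minusCount_le {n : ℕ} {x : Config} (hx : InWindow n x) :
    minusCount x ≤ n := by
  obtain ⟨a, ha⟩ := hx
  unfold minusCount
  rw [tsum_eq_sum (s := Finset.Ico a (a + n))]
  · calc ∑ k ∈ Finset.Ico a (a + n), (if x k = Spin.minus then (1 : ℝ≥0∞) else 0)
        ≤ ∑ k ∈ Finset.Ico a (a + n), 1 := by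
          gcongr
          split_ifs <;> simp
      _ = n := by simp
  · intro k hk
    rw [if_neg]
    intro h
    exact hk (Finset.mem_Ico.2 (ha k h))

/-- In a bounded configuration with a minus, some plus has a minus to its right. -/
theorem InWindow.exists_plus_minus {n : ℕ} {x : Config} (hx : InWindow n x) (h : x ≠ allPlus) :
    ∃ k, x k = Spin.plus ∧ x (k + 1) = Spin.minus := by
  obtain ⟨a, ha⟩ := hx
  obtain ⟨k, hk⟩ := exists_minus_of_ne_allPlus h
  by_contra! hc
  -- Otherwise minuses propagate to the left for ever and leave the window.
  have hall : ∀ m : ℕ, x (k - m) = Spin.minus := by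
    intro m
    induction m with
    | zero => simpa using hk
    | succ m ih =>
      by_contra hm
      refine hc (k - (m + 1 : ℕ)) (by simpa using hm) ?_
      rw [← ih]
      congr 1
      push_cast
      ring
  have := (ha _ (hall (k - a + 1).toNat)).1
  have := (ha k hk).1
  omega

theorem InWindow.of_step {n : ℕ} {x y : Config} (hx : InWindow n x)
    (h : ∀ k, y k = Spin.minus → x k = Spin.minus ∨ x (k + 1) = Spin.minus) :
    InWindow (n + 1) y := by
  obtain ⟨a, ha⟩ := hx
  refine ⟨a - 1, fun k hk => ?_⟩
  rcases h k hk with h | h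
  · have := ha _ h
    push_cast
    omega
  · have := ha _ h
    push_cast
    omega

/-! ### One step: the drift of the number of minuses. -/

theorem spinLaw_minus (p : I) : spinLaw p {Spin.minus} = ENNReal.ofReal (1 - (p : ℝ)) := by
  simp [spinLaw]

theorem stepLaw_eval_minus (α β : I) (x : Config) (k : ℤ) :
    stepLaw α β x {y | y k = Spin.minus}
      = ENNReal.ofReal (1 - (thetaPlus α β (x k) (x (k + 1)) : ℝ)) := by
  rw [← spinLaw_minus]
  have h := (measurePreserving_eval_infinitePi
    (fun k : ℤ => spinLaw (thetaPlus α β (x k) (x (k + 1)))) k).measure_preimage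
    (s := {Spin.minus}) (MeasurableSet.of_discrete).nullMeasurableSet
  exact h

/-- A minus can only come from a minus at the same site or at its right neighbour. -/
theorem ae_stepLaw (α β : I) (x : Config) :
    ∀ᵐ y ∂(stepLaw α β x), ∀ k, y k = Spin.minus → x k = Spin.minus ∨ x (k + 1) = Spin.minus := by
  rw [ae_all_iff]
  intro k
  by_cases h : x k = Spin.minus ∨ x (k + 1) = Spin.minus
  · exact Filter.Eventually.of_forall fun _ _ => h
  · push Not at h
    have h1 : x k = true := by simpa using h.1
    have h2 : x (k + 1) = true := by simpa using h.2
    have h0 := stepLaw_eval_minus α β x k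
    rw [h1, h2] at h0
    simp only [thetaPlus, Set.Icc.coe_one, sub_self, ENNReal.ofReal_zero] at h0
    filter_upwards [measure_eq_zero_iff_ae_notMem.1 h0] with y hy hyk
    exact absurd hyk hy

theorem lintegral_minusCount_stepLaw (α β : I) (x : Config) :
    ∫⁻ y, minusCount y ∂(stepLaw α β x)
      = ∑' k : ℤ, ENNReal.ofReal (1 - (thetaPlus α β (x k) (x (k + 1)) : ℝ)) := by
  unfold minusCount
  rw [lintegral_tsum]
  · congr 1 with k
    rw [← stepLaw_eval_minus, ← lintegral_indicator_one]
    · congr 1 with y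
      simp [Set.indicator_apply]
    · exact (measurable_pi_apply k : Measurable fun y : Config => y k)
        (MeasurableSet.of_discrete (s := {Spin.minus}))
  · intro k
    exact ((measurable_of_countable
      fun s : Spin => if s = Spin.minus then (1 : ℝ≥0∞) else 0).comp
      (measurable_pi_apply k)).aemeasurable

/-- Translation invariance. The weights are chosen to match the transition probabilities at every
pair but ⊕⊖. -/
theorem tsum_minus_average (α : I) (x : Config) :
    ∑' k : ℤ, (ENNReal.ofReal (1 - (α : ℝ)) * (if x k = Spin.minus then 1 else 0)
      + ENNReal.ofReal (α : ℝ) * (if x (k + 1) = Spin.minus then 1 else 0)) = minusCount x := by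
  rw [ENNReal.tsum_add, ENNReal.tsum_mul_left, ENNReal.tsum_mul_left]
  have h : ∑' k : ℤ, (if x (k + 1) = Spin.minus then (1 : ℝ≥0∞) else 0) = minusCount x :=
    (Equiv.addRight (1 : ℤ)).tsum_eq fun k => if x k = Spin.minus then (1 : ℝ≥0∞) else 0
  rw [h]
  change _ * minusCount x + _ = _
  rw [← add_mul, ← ENNReal.ofReal_add (by linarith [α.2.2]) α.2.1]
  simp

theorem minusCount_le_lintegral_stepLaw {α β : I} (h : (α : ℝ) ≤ 1 - (β : ℝ)) (x : Config) :
    minusCount x ≤ ∫⁻ y, minusCount y ∂(stepLaw α β x) := by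
  rw [lintegral_minusCount_stepLaw, ← tsum_minus_average α x]
  refine ENNReal.tsum_le_tsum fun k => ?_
  -- The pairs left are ⊖⊖, where 1 = (1 - α) + α, and ⊕⊖, where α ≤ 1 - β is used.
  rcases hk : x k with _ | _ <;> rcases hk' : x (k + 1) with _ | _ <;> simp [thetaPlus]
  · rw [← ENNReal.ofReal_add (by linarith [α.2.2]) α.2.1]
    simp
  · exact ENNReal.ofReal_le_ofReal h

theorem lintegral_stepLaw_add_le {α β : I} (h : 1 - (β : ℝ) < (α : ℝ)) {n : ℕ} {x : Config}
    (hx : InWindow n x) (hne : x ≠ allPlus) :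
    ∫⁻ y, minusCount y ∂(stepLaw α β x) + ENNReal.ofReal (α + β - 1 : ℝ) ≤ minusCount x := by
  rw [lintegral_minusCount_stepLaw]
  obtain ⟨k₀, h₁, h₂⟩ := hx.exists_plus_minus hne
  -- The gain is spread over all pairs ⊕⊖, so that the comparison can be made term by term.
  have hle : ENNReal.ofReal (α + β - 1 : ℝ) ≤ ∑' k : ℤ, ENNReal.ofReal (α + β - 1 : ℝ) *
      (if x k = Spin.plus ∧ x (k + 1) = Spin.minus then 1 else 0) := by
    refine le_trans ?_ (ENNReal.le_tsum k₀)
    simp [h₁, h₂]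
  refine (add_le_add_right hle _).trans ?_
  rw [← ENNReal.tsum_add, ← tsum_minus_average α x]
  refine ENNReal.tsum_le_tsum fun k => ?_
  rcases hk : x k with _ | _ <;> rcases hk' : x (k + 1) with _ | _ <;> simp [thetaPlus]
  · rw [← ENNReal.ofReal_add (by linarith [α.2.2]) α.2.1]
    simp
  · rw [← ENNReal.ofReal_add (by linarith [β.2.2]) (by linarith)]
    exact ENNReal.ofReal_le_ofReal (by linarith)

/-! ### The Markov property along trajectories. -/

section Trajectory

variable (α β : I) (μ : Measure Config) [IsProbabilityMeasure μ]

instance processLaw.instIsProbabilityMeasure : IsProbabilityMeasure (processLaw α β μ) := by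
  unfold processLaw
  infer_instance

theorem processLaw_map_zero : (processLaw α β μ).map (fun ω => ω 0) = μ := by
  have hc : (fun ω : ℕ → Config => ω 0) = (fun h : (i : Finset.Iic 0) → Config =>
      h ⟨0, Finset.mem_Iic.2 le_rfl⟩) ∘ Preorder.frestrictLe (π := fun _ : ℕ => Config) 0 := rfl
  rw [hc, ← Measure.map_map (measurable_pi_apply _) (by fun_prop), processLaw,
    Kernel.trajMeasure, Measure.map_comp _ _ (by fun_prop), Kernel.traj_map_frestrictLe,
    Kernel.partialTraj_self, Measure.id_comp, Measure.map_map (measurable_pi_apply _)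
    (by fun_prop)]
  exact Measure.map_id

theorem lintegral_processLaw_succ (n : ℕ) {f : Config × Config → ℝ≥0∞} (hf : Measurable f) :
    ∫⁻ ω, f (ω n, ω (n + 1)) ∂(processLaw α β μ)
      = ∫⁻ ω, ∫⁻ y, f (ω n, y) ∂(stepLaw α β (ω n)) ∂(processLaw α β μ) := by
  set κ : (n : ℕ) → Kernel ((i : Finset.Iic n) → Config) Config := fun n =>
    (kernelF α β).comap (fun h : (i : Finset.Iic n) → Config => h ⟨n, Finset.mem_Iic.2 le_rfl⟩)
      (measurable_pi_apply _) with hκ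
  have h := Kernel.map_frestrictLe_trajMeasure_compProd_eq_map_trajMeasure
    (X := fun _ : ℕ => Config) (μ₀ := μ) (κ := κ) (a := n)
  have hg : Measurable fun p : ((i : Finset.Iic n) → Config) × Config =>
      f (p.1 ⟨n, Finset.mem_Iic.2 le_rfl⟩, p.2) := by
    fun_prop
  have h' := congrArg (fun ν => ∫⁻ p, f (p.1 ⟨n, Finset.mem_Iic.2 le_rfl⟩, p.2) ∂ν) h
  beta_reduce at h'
  rw [lintegral_map hg (by fun_prop), Measure.lintegral_compProd hg,
    lintegral_map (Measurable.lintegral_kernel_prod_right' hg) (by fun_prop)] at h'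
  exact h'.symm

theorem ae_processLaw_step : ∀ᵐ ω ∂(processLaw α β μ), ∀ n k,
    ω (n + 1) k = Spin.minus → ω n k = Spin.minus ∨ ω n (k + 1) = Spin.minus := by
  rw [ae_all_iff]
  intro n
  set B : Set (Config × Config) := {p | ∀ k,
    p.2 k = Spin.minus → p.1 k = Spin.minus ∨ p.1 (k + 1) = Spin.minus} with hB
  have hBm : MeasurableSet B := by
    rw [hB, Set.ofPred_forall]
    refine MeasurableSet.iInter fun k => ?_
    have hm : Measurable fun p : Config × Config => (p.2 k, p.1 k, p.1 (k + 1)) := by fun_prop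
    exact hm (MeasurableSet.of_discrete
      (s := {q : Spin × Spin × Spin | q.1 = Spin.minus → q.2.1 = Spin.minus ∨ q.2.2 = Spin.minus}))
  -- The indicator of the forbidden transitions has integral zero under every one-step law, hence
  -- along the trajectory.
  have h := lintegral_processLaw_succ α β μ n
    (f := Bᶜ.indicator 1) (measurable_one.indicator hBm.compl)
  have h0 : ∀ ω : ℕ → Config,
      ∫⁻ y, Bᶜ.indicator (1 : Config × Config → ℝ≥0∞) (ω n, y) ∂(stepLaw α β (ω n)) = 0 := by
    intro ω
    rw [← lintegral_zero (μ := stepLaw α β (ω n))]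
    refine lintegral_congr_ae ?_
    filter_upwards [ae_stepLaw α β (ω n)] with y hy
    exact Set.indicator_of_notMem (s := Bᶜ) (not_not.2 (show (ω n, y) ∈ B from hy)) _
  simp only [h0, lintegral_zero] at h
  have hm : Measurable fun ω : ℕ → Config =>
      Bᶜ.indicator (1 : Config × Config → ℝ≥0∞) (ω n, ω (n + 1)) :=
    (measurable_one.indicator hBm.compl).comp
      ((measurable_pi_apply n).prodMk (measurable_pi_apply (n + 1)))
  rw [lintegral_eq_zero_iff hm] at h
  filter_upwards [h] with ω hω
  by_contra hc
  have hmem : (ω n, ω (n + 1)) ∈ Bᶜ := hc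
  simp [Set.indicator_of_mem hmem] at hω

theorem lintegral_minusCount_zero :
    ∫⁻ ω, minusCount (ω 0) ∂(processLaw α β μ) = ∫⁻ x, minusCount x ∂μ := by
  conv_rhs => rw [← processLaw_map_zero α β μ]
  rw [lintegral_map measurable_minusCount (by fun_prop)]

theorem lintegral_minusCount_succ (n : ℕ) :
    ∫⁻ ω, minusCount (ω (n + 1)) ∂(processLaw α β μ)
      = ∫⁻ ω, ∫⁻ y, minusCount y ∂(stepLaw α β (ω n)) ∂(processLaw α β μ) :=
  lintegral_processLaw_succ α β μ n (f := fun p => minusCount p.2)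
    (measurable_minusCount.comp measurable_snd)

end Trajectory

/-! ### From a finite giant to a uniform window. -/

/-- An island is either "all pluses" or has a length. -/
theorem exists_hasLength {x : Config} (hx : x ∈ islandsOfMinuses) (hne : x ≠ allPlus) :
    ∃ n, HasLength Spin.minus x n ∧ InWindow n x := by
  have hfin : {i : ℤ | x i ≠ allPlus i}.Finite := hx
  set s := hfin.toFinset with hs
  have hmem : ∀ k, k ∈ s ↔ x k = Spin.minus := by
    intro k
    simp [hs, allPlus]
  obtain ⟨k, hk⟩ := exists_minus_of_ne_allPlus hne
  have hsne : s.Nonempty := ⟨k, (hmem k).2 hk⟩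
  have hle := s.min'_le_max' hsne
  refine ⟨(s.max' hsne - s.min' hsne + 1).toNat,
    ⟨s.min' hsne - 1, s.max' hsne + 1, by omega, ?_, ?_, ?_, by omega⟩, s.min' hsne, ?_⟩
  · rw [sub_add_cancel]
    exact (hmem _).1 (s.min'_mem hsne)
  · rw [add_sub_cancel_right]
    exact (hmem _).1 (s.max'_mem hsne)
  · intro k hk
    by_contra hc
    have hks : k ∈ s := (hmem k).2 (by simpa using hc)
    have h1 := s.min'_le k hks
    have h2 := s.le_max' k hks
    omega
  · intro k hk
    have h1 := s.min'_le k ((hmem k).2 hk)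
    have h2 := s.le_max' k ((hmem k).2 hk)
    omega

theorem countable_islandsOfMinuses : islandsOfMinuses.Countable := by
  refine Set.Countable.mono (s₂ := Set.range fun s : Finset ℤ => fun k : ℤ => decide (k ∉ s)) ?_
    (Set.countable_range _)
  intro x hx
  have hfin : {i : ℤ | x i ≠ allPlus i}.Finite := hx
  refine ⟨hfin.toFinset, funext fun k => ?_⟩
  rcases h : x k with _ | _ <;> simp [allPlus, h]

theorem ae_measure_singleton_ne_zero {X : Type*} [MeasurableSpace X] {μ : Measure X} {s : Set X}
    (hs : s.Countable) (hμ : ∀ᵐ x ∂μ, x ∈ s) : ∀ᵐ x ∂μ, μ {x} ≠ 0 := by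
  have h : μ {x | x ∈ s ∧ μ {x} = 0} = 0 := by
    refine (measure_null_iff_singleton (hs.mono fun x hx => hx.1)).2 fun x hx => hx.2
  filter_upwards [hμ, measure_eq_zero_iff_ae_notMem.1 h] with x hx hx' h0
  exact hx' ⟨hx, h0⟩

theorem exists_ae_inWindow (μ : Measure Config) [IsProbabilityMeasure μ]
    (hμ : IsArchipelagoOfMinuses μ) (hgiant : giant μ < ⊤) :
    ∃ M : ℕ, ∀ᵐ x ∂μ, InWindow M x := by
  lift giant μ to ℕ using hgiant.ne with M hM
  refine ⟨M, ?_⟩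
  filter_upwards [hμ, ae_measure_singleton_ne_zero countable_islandsOfMinuses hμ] with x hx hx0
  by_cases hne : x = allPlus
  -- "All pluses" has no minus, so any window serves.
  · exact ⟨0, fun k hk => by simp [hne, allPlus] at hk⟩
  obtain ⟨n, hn, a, ha⟩ := exists_hasLength hx hne
  have hle : (n : ℕ∞) ≤ M := by
    rw [hM]
    exact le_sSup ⟨_, x, n, hx0, hn, rfl⟩
  have hle' : n ≤ M := by exact_mod_cast hle
  refine ⟨a, fun k hk => ?_⟩
  have := ha k hk
  omega

/-! ### The mean hitting time of "all pluses". -/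

/-- For a trajectory absorbed by "all pluses", the hitting time counts the earlier times. -/
theorem hitTime_allPlus_eq_tsum {ω : ℕ → Config}
    (h : ∀ n, ω n = allPlus → ω (n + 1) = allPlus) :
    hitTime {allPlus} ω = ∑' n : ℕ, {x : Config | x ≠ allPlus}.indicator 1 (ω n) := by
  classical
  by_cases hex : ∃ n, ω n = allPlus
  · have hafter : ∀ n, Nat.find hex ≤ n → ω n = allPlus := by
      intro n hn
      induction n, hn using Nat.le_induction with
      | base => exact Nat.find_spec hex
      | succ n _ ih => exact h n ih
    rw [tsum_eq_sum (s := Finset.range (Nat.find hex))]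
    · rw [Finset.sum_congr rfl (g := fun _ => 1)]
      · simp only [Finset.sum_const, Finset.card_range, nsmul_eq_mul, mul_one]
        refine le_antisymm (iInf₂_le (Nat.find hex) (Nat.find_spec hex)) (le_iInf₂ fun t ht => ?_)
        exact_mod_cast Nat.find_min' hex ht
      · intro n hn
        exact Set.indicator_of_mem (Nat.find_min hex (Finset.mem_range.1 hn)) _
    · intro n hn
      exact Set.indicator_of_notMem (s := {x : Config | x ≠ allPlus})
        (not_not.2 (hafter n (by simpa using hn))) _
  · push Not at hex
    have h1 : ∀ n, {x : Config | x ≠ allPlus}.indicator (1 : Config → ℝ≥0∞) (ω n) = 1 :=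
      fun n => Set.indicator_of_mem (hex n) _
    simp_rw [h1]
    rw [ENNReal.tsum_const_eq_top_of_ne_zero one_ne_zero]
    simp [hitTime, hex]

theorem measurable_indicator_ne_allPlus (n : ℕ) : Measurable fun ω : ℕ → Config =>
    {x : Config | x ≠ allPlus}.indicator (1 : Config → ℝ≥0∞) (ω n) :=
  (measurable_one.indicator (measurableSet_singleton allPlus).compl).comp (measurable_pi_apply n)

theorem tsum_inv_add_eq_top (M : ℕ) : ∑' n : ℕ, ((M + 1 + n : ℕ) : ℝ≥0∞)⁻¹ = ⊤ := by
  by_contra h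
  have hs := ENNReal.summable_toReal h
  refine Real.not_summable_natCast_inv ((summable_nat_add_iff (M + 1)).1 ?_)
  refine hs.congr fun n => ?_
  rw [ENNReal.toReal_inv, ENNReal.toReal_natCast, add_comm n]

theorem ae_inWindow_and_absorbed (α β : I) {μ : Measure Config} [IsProbabilityMeasure μ]
    {M : ℕ} (hM : ∀ᵐ x ∂μ, InWindow M x) : ∀ᵐ ω ∂(processLaw α β μ),
      (∀ n, InWindow (M + n) (ω n)) ∧ ∀ n, ω n = allPlus → ω (n + 1) = allPlus := by
  have h0 : ∀ᵐ ω ∂(processLaw α β μ), InWindow M (ω 0) := by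
    rw [← processLaw_map_zero α β μ] at hM
    exact ae_of_ae_map (measurable_pi_apply 0).aemeasurable hM
  filter_upwards [h0, ae_processLaw_step α β μ] with ω hω hstep
  refine ⟨fun n => ?_, fun n hn => ?_⟩
  · induction n with
    | zero => exact hω
    | succ n ih => exact ih.of_step (hstep n)
  · by_contra hc
    obtain ⟨k, hk⟩ := exists_minus_of_ne_allPlus hc
    have := hstep n k hk
    simp [hn, allPlus] at this

theorem lintegral_hitTime_allPlus (α β : I) {μ : Measure Config} [IsProbabilityMeasure μ]
    {M : ℕ} (hM : ∀ᵐ x ∂μ, InWindow M x) :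
    ∫⁻ ω, hitTime {allPlus} ω ∂(processLaw α β μ)
      = ∑' n : ℕ, ∫⁻ ω, {x : Config | x ≠ allPlus}.indicator 1 (ω n) ∂(processLaw α β μ) := by
  rw [← lintegral_tsum]
  · refine lintegral_congr_ae ?_
    filter_upwards [ae_inWindow_and_absorbed α β hM] with ω hω
    exact hitTime_allPlus_eq_tsum hω.2
  · exact fun n => (measurable_indicator_ne_allPlus n).aemeasurable

/-- Foster's argument with N as Lyapunov function: the mean is at most M / (α + β - 1). -/
theorem lintegral_hitTime_allPlus_lt_top {α β : I} {μ : Measure Config} [IsProbabilityMeasure μ]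
    {M : ℕ} (hM : ∀ᵐ x ∂μ, InWindow M x) (h : 1 - (β : ℝ) < (α : ℝ)) :
    ∫⁻ ω, hitTime {allPlus} ω ∂(processLaw α β μ) < ⊤ := by
  rw [lintegral_hitTime_allPlus α β hM]
  set p : ℕ → ℝ≥0∞ := fun n =>
    ∫⁻ ω, {x : Config | x ≠ allPlus}.indicator 1 (ω n) ∂(processLaw α β μ) with hp
  set δ := ENNReal.ofReal (α + β - 1 : ℝ) with hδ
  have hδ0 : δ ≠ 0 := by
    rw [hδ, ne_eq, ENNReal.ofReal_eq_zero]
    linarith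
  have hstep : ∀ n, ∫⁻ ω, minusCount (ω (n + 1)) ∂(processLaw α β μ) + δ * p n
      ≤ ∫⁻ ω, minusCount (ω n) ∂(processLaw α β μ) := by
    intro n
    have hm := measurable_indicator_ne_allPlus n
    rw [lintegral_minusCount_succ, hp, ← lintegral_const_mul _ hm,
      ← lintegral_add_right _ (hm.const_mul δ)]
    refine lintegral_mono_ae ?_
    filter_upwards [ae_inWindow_and_absorbed α β hM] with ω hω
    by_cases hne : ω n = allPlus
    · rw [Set.indicator_of_notMem (by simp [hne]), mul_zero, add_zero, hne,
        lintegral_minusCount_stepLaw]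
      simp [allPlus, thetaPlus]
    · rw [Set.indicator_of_mem (by exact hne), Pi.one_apply, mul_one]
      exact lintegral_stepLaw_add_le h (hω.1 n) hne
  -- Telescoping in additive form, which avoids subtraction in `ℝ≥0∞`.
  have hsum : ∀ n, ∫⁻ ω, minusCount (ω n) ∂(processLaw α β μ) + δ * ∑ i ∈ Finset.range n, p i
      ≤ M := by
    intro n
    induction n with
    | zero =>
      rw [Finset.sum_range_zero, mul_zero, add_zero, lintegral_minusCount_zero]
      refine (lintegral_mono_ae (hM.mono fun x hx => hx.minusCount_le)).trans ?_
      simp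
    | succ n ih =>
      refine le_trans ?_ ih
      rw [Finset.sum_range_succ, mul_add, add_comm (δ * _), ← add_assoc]
      gcongr
      exact hstep n
  have hle : ∑' n, p n ≤ M / δ := by
    rw [ENNReal.tsum_eq_iSup_nat]
    refine iSup_le fun n => ?_
    rw [ENNReal.le_div_iff_mul_le (Or.inl hδ0) (Or.inl ENNReal.ofReal_ne_top), mul_comm]
    exact le_add_self.trans (hsum n)
  exact hle.trans_lt (ENNReal.div_lt_top (ENNReal.natCast_ne_top M) hδ0)

theorem eq_dirac_of_ae_eq {X : Type*} [MeasurableSpace X] {μ : Measure X}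
    [IsProbabilityMeasure μ] {a : X} (h : ∀ᵐ x ∂μ, x = a) : μ = Measure.dirac a := by
  have hmap : μ.map id = μ.map fun _ => a := Measure.map_congr h
  simpa using hmap

theorem lintegral_hitTime_allPlus_eq_top {α β : I} {μ : Measure Config} [IsProbabilityMeasure μ]
    {M : ℕ} (hM : ∀ᵐ x ∂μ, InWindow M x) (h : (α : ℝ) ≤ 1 - (β : ℝ))
    (hμ : μ ≠ Measure.dirac allPlus) :
    ∫⁻ ω, hitTime {allPlus} ω ∂(processLaw α β μ) = ⊤ := by
  rw [lintegral_hitTime_allPlus α β hM]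
  set c := ∫⁻ x, minusCount x ∂μ with hc
  have hc0 : c ≠ 0 := by
    intro h0
    rw [hc, lintegral_eq_zero_iff measurable_minusCount] at h0
    refine hμ (eq_dirac_of_ae_eq ?_)
    filter_upwards [h0] with x hx
    by_contra hne
    have := one_le_minusCount hne
    simp [hx] at this
  have hmono : ∀ n, c ≤ ∫⁻ ω, minusCount (ω n) ∂(processLaw α β μ) := by
    intro n
    induction n with
    | zero => rw [lintegral_minusCount_zero]
    | succ n ih =>
      rw [lintegral_minusCount_succ]
      exact ih.trans (lintegral_mono fun ω => minusCount_le_lintegral_stepLaw h (ω n))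
  -- N vanishes at "all pluses" and is at most M + n elsewhere, so c is at most (M + 1 + n) times
  -- the probability of non-absorption.
  have hbound : ∀ n : ℕ, c * ((M + 1 + n : ℕ) : ℝ≥0∞)⁻¹
      ≤ ∫⁻ ω, {x : Config | x ≠ allPlus}.indicator 1 (ω n) ∂(processLaw α β μ) := by
    intro n
    rw [← div_eq_mul_inv]
    refine ENNReal.div_le_of_le_mul' ((hmono n).trans ?_)
    rw [← lintegral_const_mul _ (measurable_indicator_ne_allPlus n)]
    refine lintegral_mono_ae ?_
    filter_upwards [ae_inWindow_and_absorbed α β hM] with ω hω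
    by_cases hne : ω n = allPlus
    · simp [hne, minusCount_allPlus]
    · rw [Set.indicator_of_mem (by exact hne), Pi.one_apply, mul_one]
      refine (hω.1 n).minusCount_le.trans ?_
      exact_mod_cast (by omega : M + n ≤ M + 1 + n)
  rw [eq_top_iff]
  calc (⊤ : ℝ≥0∞) = c * ∑' n : ℕ, ((M + 1 + n : ℕ) : ℝ≥0∞)⁻¹ := by
        rw [tsum_inv_add_eq_top, ENNReal.mul_top hc0]
    _ = ∑' n : ℕ, c * ((M + 1 + n : ℕ) : ℝ≥0∞)⁻¹ := ENNReal.tsum_mul_left.symm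
    _ ≤ _ := ENNReal.tsum_le_tsum hbound

theorem theorem3 (α β : I) (hα : 0 < α) (μ : Measure Config) [IsProbabilityMeasure μ]
    (hμ : IsArchipelagoOfMinuses μ) (hgiant : giant μ < ⊤) :
    (∀ᵐ ω ∂(processLaw α β μ), tau ω = hitTime {allPlus} ω) ∧
    (1 - (β : ℝ) < (α : ℝ) → ∫⁻ ω, tau ω ∂(processLaw α β μ) < ⊤) ∧
    ((α : ℝ) ≤ 1 - (β : ℝ) → μ ≠ Measure.dirac allPlus →
      ∫⁻ ω, tau ω ∂(processLaw α β μ) = ⊤) := by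
  obtain ⟨M, hM⟩ := exists_ae_inWindow μ hμ hgiant
  have htau : ∀ᵐ ω ∂(processLaw α β μ), tau ω = hitTime {allPlus} ω := by
    filter_upwards [ae_inWindow_and_absorbed α β hM] with ω hω
    -- Minuses stay in a finite window at each time, so "all minuses" is never reached.
    simp [tau, hitTime, fun n => (hω.1 n).ne_allMinus]
  refine ⟨htau, fun h => ?_, fun h hne => ?_⟩
  · rw [lintegral_congr_ae htau]
    exact lintegral_hitTime_allPlus_lt_top hM h
  · rw [lintegral_congr_ae htau]
    exact lintegral_hitTime_allPlus_eq_top hM h hne
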